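/- **Setting.** Let $p>2$ and $p'=p/(p-1)\in(1,2)$. Let $\Omega\subset\mathbb{R}^d$ be a bounded Lipschitz domain with a regular (conforming simplicial) triangulation $\mathcal{T}$. For fixed degrees $k,\delta\in\mathbb{N}=\{1,2,\dots\}$ let $U_h\subset W^{1,p'}_0(\Omega)$ and $V_h\subset W^{1,p}_0(\Omega)$ be the subspaces of functions that are polynomials of degree at most $k$, respectively at most $k+\delta$, on every $T\in\mathcal{T}$. Let $B\colon W^{1,p'}_0(\Omega)\to W^{-1,p}(\Omega):=(W^{1,p}_0(\Omega))^*$ be bounded and linear, let $F\in W^{-1,p}(\Omega)$, and set $$(BU_h)^\perp:=\{v_h\in V_h : (Bu_h)(v_h)=0\text{ for all }u_h\in U_h\},$$ $$\Sigma:=\Big\{\tau\in L^{p'}(\Omega;\mathbb{R}^d) : \int_\Omega\nabla v_h\cdot\tau\,dx=F(v_h)\text{ for all }v_h\in(BU_h)^\perp\Big\}.$$ For $0<\zeta_-\le\zeta_+<\infty$ and $\zeta=[\zeta_-,\zeta_+]$ let $$\kappa^*_\zeta(t):=\begin{cases}\frac12\zeta_-^{p'-2}t^2+\big(\frac1{p'}-\frac12\big)\zeta_-^{p'}&\text{for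 } 0\le t\le\zeta_-,\\ \frac1{p'}t^{p'}&\text{for }\zeta_-\le t\le\zeta_+,\\ \frac12\zeta_+^{p'-2}t^2+\big(\frac1{p'}-\frac12\big)\zeta_+^{p'}&\text{for } t\ge\zeta_+,\end{cases}\qquad \mathcal{J}^*_\zeta(\tau):=\int_\Omega\kappa^*_\zeta(|\tau|)\,dx\in[0,\infty]$$ for $\tau\in L^{p'}(\Omega;\mathbb{R}^d)$, and let $\sigma_\zeta$ be the minimizer of $\mathcal{J}^*_\zeta$ in $\Sigma$. Given $\sigma_0\in L^{p'}(\Omega;\mathbb{R}^d)$, let $\sigma_{n+1}\in L^{p'}(\Omega;\mathbb{R}^d)$ and $\psi_{h,n+1}\in(BU_h)^\perp$, $n=0,1,2,\dots$, be the iterates of the relaxed Kačanov scheme, that is, for all $\tau\in L^{p'}(\Omega;\mathbb{R}^d)$ and all $v_h\in(BU_h)^\perp$ $$\int_\Omega\big(\max\{\zeta_-,\min\{|\sigma_n|,\zeta_+\}\}\big)^{p'-2}\sigma_{n+1}\cdot\tau\,dx-\int_\Omega\nabla\psi_{h,n+1}\cdot\tau\,dx=0,\qquad -\int_\Omega\nabla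 v_h\cdot\sigma_{n+1}\,dx=-F(v_h).$$ **Proposition (Convergence).** There is a constant $c\in(0,1)$ that depends only on $p$ such that $\rho:=c\,(\zeta_- /\zeta_+)^{2-p'}$ has the following properties. The energies $\mathcal{J}^*_\zeta(\sigma_\zeta)$ and $\mathcal{J}^*_\zeta(\sigma_n)$, $n\ge1$, are finite; $$\rho\,\big(\mathcal{J}^*_\zeta(\sigma_n)-\mathcal{J}^*_\zeta(\sigma_\zeta)\big)\le\mathcal{J}^*_\zeta(\sigma_n)-\mathcal{J}^*_\zeta(\sigma_{n+1})\qquad\text{for all }n\ge1;$$ and $$\mathcal{J}^*_\zeta(\sigma_{n+1})-\mathcal{J}^*_\zeta(\sigma_\zeta)\le(1-\rho)^n\big(\mathcal{J}^*_\zeta(\sigma_1)-\mathcal{J}^*_\zeta(\sigma_\zeta)\big)\qquad\text{for all }n\ge0.$$ If moreover $\sigma_0\in\Sigma$, then the first inequality also holds for $n=0$, and $$\mathcal{J}^*_\zeta(\sigma_{n+1})-\mathcal{J}^*_\zeta(\sigma_\zeta)\le(1-\rho)^n\big(\mathcal{J}^*_\zeta(\sigma_0)-\mathcal{J}^*_\zeta(\sigma_\zeta)\big)\qquad\text{for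 all }n\ge0$$ (both with values in $(-\infty,\infty]$ if $\mathcal{J}^*_\zeta(\sigma_0)=\infty$). -/

import Mathlib

open MeasureTheory Set
open scoped ENNReal NNReal ContDiff

namespace Kacanov

noncomputable section

/-- Since `p > 2`, the exponent `p` is admissible for the Banach space `L^p`. -/
instance factOneLe (p : ℝ) [hp : Fact (2 < p)] : Fact (1 ≤ ENNReal.ofReal p) :=
  ⟨by
    have h := hp.out
    rw [ENNReal.one_le_ofReal]
    linarith⟩

/-- Since `p > 2`, the conjugate exponent `p' = p / (p - 1)` is admissible as well. -/
instance factOneLeConj (p : ℝ) [hp : Fact (2 < p)] :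
    Fact (1 ≤ ENNReal.ofReal p.conjExponent) :=
  ⟨by
    have h := hp.out
    rw [ENNReal.one_le_ofReal, Real.conjExponent, le_div_iff₀ (by linarith)]
    linarith⟩

variable {d : ℕ}

/-! ### Domains and triangulations -/

/-- A bounded Lipschitz domain: a nonempty, connected, open, bounded set which near each of its
boundary points is the strict epigraph, in some direction `e`, of a Lipschitz function of the
coordinates orthogonal to `e` (a Lipschitz function that is constant in the direction `e`). -/
structure IsBoundedLipschitzDomain (Ω : Set (EuclideanSpace ℝ (Fin d))) : Prop where
  isOpen : IsOpen Ω
  isConnected : IsConnected Ω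
  isBounded : Bornology.IsBounded Ω
  lipschitz_boundary : ∀ x ∈ frontier Ω,
    ∃ (e : EuclideanSpace ℝ (Fin d)) (g : EuclideanSpace ℝ (Fin d) → ℝ) (K : ℝ≥0)
      (U : Set (EuclideanSpace ℝ (Fin d))),
      ‖e‖ = 1 ∧ LipschitzWith K g ∧ (∀ y (t : ℝ), g (y + t • e) = g y) ∧
      IsOpen U ∧ x ∈ U ∧ Ω ∩ U = {y ∈ U | g y < inner ℝ e y}

/-- A regular (that is, conforming) triangulation of `Ω`: finitely many nondegenerate closed
`d`-simplices, given by their vertex sets, which cover the closure of `Ω`, any two of which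
intersect exactly in the common face spanned by their common vertices (possibly empty). -/
structure Triangulation (Ω : Set (EuclideanSpace ℝ (Fin d))) where
  cells : Finset (Finset (EuclideanSpace ℝ (Fin d)))
  card_eq : ∀ T ∈ cells, T.card = d + 1
  affineIndependent : ∀ T ∈ cells,
    AffineIndependent ℝ (fun x : {x // x ∈ T} => (x : EuclideanSpace ℝ (Fin d)))
  cover : (⋃ T ∈ cells, convexHull ℝ (T : Set (EuclideanSpace ℝ (Fin d)))) = closure Ω
  conforming : ∀ T ∈ cells, ∀ T' ∈ cells,
    convexHull ℝ (T : Set (EuclideanSpace ℝ (Fin d))) ∩ convexHull ℝ (T' : Set _) =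
      convexHull ℝ ((T : Set (EuclideanSpace ℝ (Fin d))) ∩ (T' : Set _))

/-! ### Lebesgue and Sobolev spaces -/

/-- The space `L^q(Ω; ℝ^d)`. -/
abbrev LVec (Ω : Set (EuclideanSpace ℝ (Fin d))) (q : ℝ) :=
  Lp (EuclideanSpace ℝ (Fin d)) (ENNReal.ofReal q) (volume.restrict Ω)

/-- The pairs `(φ, ∇φ)` with a test function `φ ∈ C_c^∞(Ω)`. -/
def testPairs (Ω : Set (EuclideanSpace ℝ (Fin d))) (q : ℝ) :
    Set (Lp ℝ (ENNReal.ofReal q) (volume.restrict Ω) × LVec Ω q) :=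
  {w | ∃ φ : EuclideanSpace ℝ (Fin d) → ℝ,
    ContDiff ℝ ∞ φ ∧ HasCompactSupport φ ∧ tsupport φ ⊆ Ω ∧
    (w.1 =ᵐ[volume.restrict Ω] φ) ∧ (w.2 =ᵐ[volume.restrict Ω] gradient φ)}

/-- The Sobolev space `W_0^{1,q}(Ω)`, the closure of `C_c^∞(Ω)` in the `W^{1,q}` norm.
A function `v` is represented by the pair `(v, ∇v) ∈ L^q(Ω) × L^q(Ω; ℝ^d)` of the function and
its weak gradient; the product norm is equivalent to the usual `W^{1,q}` norm. -/
def W0 (Ω : Set (EuclideanSpace ℝ (Fin d))) (q : ℝ) [Fact (1 ≤ ENNReal.ofReal q)] :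
    Submodule ℝ (Lp ℝ (ENNReal.ofReal q) (volume.restrict Ω) × LVec Ω q) :=
  (Submodule.span ℝ (testPairs Ω q)).topologicalClosure

/-- The function `v` itself, as an element of `L^q(Ω)`. -/
def fn {Ω : Set (EuclideanSpace ℝ (Fin d))} {q : ℝ} [Fact (1 ≤ ENNReal.ofReal q)]
    : W0 Ω q →L[ℝ] Lp ℝ (ENNReal.ofReal q) (volume.restrict Ω) :=
  (ContinuousLinearMap.fst ℝ _ _).comp (W0 Ω q).subtypeL

/-- The weak gradient `∇v`, as an element of `L^q(Ω; ℝ^d)`. -/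
def grad {Ω : Set (EuclideanSpace ℝ (Fin d))} {q : ℝ} [Fact (1 ≤ ENNReal.ofReal q)]
    : W0 Ω q →L[ℝ] LVec Ω q :=
  (ContinuousLinearMap.snd ℝ _ _).comp (W0 Ω q).subtypeL

/-- For `1/p + 1/p' = 1`, the space `W^{-1,p}(Ω) := (W_0^{1,p}(Ω))^*`. -/
abbrev WNeg (Ω : Set (EuclideanSpace ℝ (Fin d))) (p : ℝ) [Fact (1 ≤ ENNReal.ofReal p)] :=
  StrongDual ℝ (W0 Ω p)

/-! ### Lagrange finite elements -/

/-- `w` agrees on every simplex of the triangulation (almost everywhere) with a polynomial of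
total degree at most `ℓ`. On a bounded `Ω` such a `w` is automatically in `L^2(Ω)`. -/
def IsPiecewisePoly {Ω : Set (EuclideanSpace ℝ (Fin d))} (𝒯 : Triangulation Ω) (ℓ : ℕ)
    (w : EuclideanSpace ℝ (Fin d) → ℝ) : Prop :=
  ∀ T ∈ 𝒯.cells, ∃ P : MvPolynomial (Fin d) ℝ, P.totalDegree ≤ ℓ ∧
    ∀ᵐ x ∂(volume.restrict Ω), x ∈ convexHull ℝ (T : Set (EuclideanSpace ℝ (Fin d))) →
      w x = MvPolynomial.eval (fun i => x i) P

theorem IsPiecewisePoly.zero {Ω : Set (EuclideanSpace ℝ (Fin d))} (𝒯 : Triangulation Ω)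
    (ℓ : ℕ) {w : EuclideanSpace ℝ (Fin d) → ℝ} (h : w =ᵐ[volume.restrict Ω] 0) :
    IsPiecewisePoly 𝒯 ℓ w := by
  intro T _
  refine ⟨0, by simp, ?_⟩
  filter_upwards [h] with x hx _
  rw [hx, map_zero, Pi.zero_apply]

theorem IsPiecewisePoly.add {Ω : Set (EuclideanSpace ℝ (Fin d))} {𝒯 : Triangulation Ω}
    {ℓ : ℕ} {u v w : EuclideanSpace ℝ (Fin d) → ℝ} (hu : IsPiecewisePoly 𝒯 ℓ u)
    (hv : IsPiecewisePoly 𝒯 ℓ v) (h : w =ᵐ[volume.restrict Ω] u + v) :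
    IsPiecewisePoly 𝒯 ℓ w := by
  intro T hT
  obtain ⟨P, hP, hP'⟩ := hu T hT
  obtain ⟨Q, hQ, hQ'⟩ := hv T hT
  refine ⟨P + Q, (MvPolynomial.totalDegree_add P Q).trans (max_le hP hQ), ?_⟩
  filter_upwards [hP', hQ', h] with x h1 h2 h3 hx
  rw [map_add, ← h1 hx, ← h2 hx, h3, Pi.add_apply]

theorem IsPiecewisePoly.smul {Ω : Set (EuclideanSpace ℝ (Fin d))} {𝒯 : Triangulation Ω}
    {ℓ : ℕ} {u w : EuclideanSpace ℝ (Fin d) → ℝ} (c : ℝ) (hu : IsPiecewisePoly 𝒯 ℓ u)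
    (h : w =ᵐ[volume.restrict Ω] c • u) : IsPiecewisePoly 𝒯 ℓ w := by
  intro T hT
  obtain ⟨P, hP, hP'⟩ := hu T hT
  refine ⟨c • P, (MvPolynomial.totalDegree_smul_le c P).trans hP, ?_⟩
  filter_upwards [hP', h] with x h1 h3 hx
  rw [MvPolynomial.smul_eval, ← h1 hx, h3, Pi.smul_apply, smul_eq_mul]

/-- The Lagrange space of the piecewise polynomials of degree at most `k` in `W_0^{1,q}(Ω)`. -/
def lagrange {Ω : Set (EuclideanSpace ℝ (Fin d))} (𝒯 : Triangulation Ω) (q : ℝ)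
    [Fact (1 ≤ ENNReal.ofReal q)] (k : ℕ) : Submodule ℝ (W0 Ω q) where
  carrier := {v | IsPiecewisePoly 𝒯 k (fn v)}
  zero_mem' := by
    rw [mem_ofPred_eq, map_zero]
    exact IsPiecewisePoly.zero 𝒯 k (Lp.coeFn_zero ℝ (ENNReal.ofReal q) (volume.restrict Ω))
  add_mem' := by
    intro u v hu hv
    rw [mem_ofPred_eq, map_add]
    exact IsPiecewisePoly.add hu hv (Lp.coeFn_add (fn u) (fn v))
  smul_mem' := by
    intro c u hu
    rw [mem_ofPred_eq, map_smul]
    exact IsPiecewisePoly.smul c hu (Lp.coeFn_smul c (fn u))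

section Scheme

variable {p : ℝ} [Fact (2 < p)] {Ω : Set (EuclideanSpace ℝ (Fin d))}

/-- The space `(B U_h)^⊥ = {v_h ∈ V_h : b(u_h, v_h) = 0 for all u_h ∈ U_h}`, where
`b(u, v) = (B u)(v)`, and where `U_h ⊆ W_0^{1,p'}(Ω)` and `V_h ⊆ W_0^{1,p}(Ω)` are the Lagrange
spaces of degree `k` and `k + δ`. -/
def BUperp (𝒯 : Triangulation Ω) (k δ : ℕ) (B : W0 Ω p.conjExponent →L[ℝ] WNeg Ω p) :
    Submodule ℝ (W0 Ω p) where
  carrier := {v | v ∈ lagrange 𝒯 p (k + δ) ∧ ∀ u ∈ lagrange 𝒯 p.conjExponent k, B u v = 0}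
  zero_mem' := ⟨Submodule.zero_mem _, fun u _ => map_zero (B u)⟩
  add_mem' := fun {v w} hv hw => ⟨Submodule.add_mem _ hv.1 hw.1, fun u hu => by
    rw [map_add (B u) v w, hv.2 u hu, hw.2 u hu, add_zero]⟩
  smul_mem' := fun c v hv => ⟨Submodule.smul_mem _ c hv.1, fun u hu => by
    rw [map_smul (B u) c v, hv.2 u hu, smul_zero]⟩

/-- The affine space of all `τ ∈ L^{p'}(Ω; ℝ^d)` with `∫_Ω ∇v_h · τ = F(v_h)` for all
`v_h ∈ (B U_h)^⊥`. -/
def Admissible (𝒯 : Triangulation Ω) (k δ : ℕ) (B : W0 Ω p.conjExponent →L[ℝ] WNeg Ω p)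
    (F : WNeg Ω p) : Set (LVec Ω p.conjExponent) :=
  {τ | ∀ v ∈ BUperp 𝒯 k δ B, ∫ x in Ω, inner ℝ (grad v x) (τ x) = F v}

/-- The regularized integrand `κ*_ζ` for `ζ = [a, b]`, with `q` in the role of `p'`. -/
def kappa (q a b t : ℝ) : ℝ :=
  if t ≤ a then 1 / 2 * a ^ (q - 2) * t ^ 2 + (1 / q - 1 / 2) * a ^ q
  else if t ≤ b then 1 / q * t ^ q
  else 1 / 2 * b ^ (q - 2) * t ^ 2 + (1 / q - 1 / 2) * b ^ q

/-- The regularized dual energy `J*_ζ(τ) = ∫_Ω κ*_ζ(|τ|)`, which is `∞` for `τ ∉ L^2`. -/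
def energy (a b : ℝ) (τ : LVec Ω p.conjExponent) : EReal :=
  ((∫⁻ x in Ω, ENNReal.ofReal (kappa p.conjExponent a b ‖τ x‖) : ℝ≥0∞) : EReal)

/-- `σ` minimizes the regularized dual energy in the admissible set. -/
def IsRegularizedMinimizer (𝒯 : Triangulation Ω) (k δ : ℕ)
    (B : W0 Ω p.conjExponent →L[ℝ] WNeg Ω p) (F : WNeg Ω p) (a b : ℝ)
    (σ : LVec Ω p.conjExponent) : Prop :=
  σ ∈ Admissible 𝒯 k δ B F ∧ ∀ τ ∈ Admissible 𝒯 k δ B F, energy a b σ ≤ energy a b τ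

/-- One step of the relaxed Kačanov iteration with `ζ = [a, b]`: the pair `(σ', ψ)` solves the
linear saddle point problem whose weight is given by the previous iterate `σ`. The product of two
functions in `L^{p'}` need not be integrable, so that the integrability of the first integrand is
part of the first equation; the other integrands are integrable by Hölder's inequality. -/
def IsKacanovStep (𝒯 : Triangulation Ω) (k δ : ℕ)
    (B : W0 Ω p.conjExponent →L[ℝ] WNeg Ω p) (F : WNeg Ω p) (a b : ℝ)
    (σ σ' : LVec Ω p.conjExponent) (ψ : W0 Ω p) : Prop :=
  ψ ∈ BUperp 𝒯 k δ B ∧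
  (∀ τ : LVec Ω p.conjExponent,
    IntegrableOn
      (fun x => (max a (min ‖σ x‖ b)) ^ (p.conjExponent - 2) * inner ℝ (σ' x) (τ x)) Ω ∧
    (∫ x in Ω, (max a (min ‖σ x‖ b)) ^ (p.conjExponent - 2) * inner ℝ (σ' x) (τ x))
      - ∫ x in Ω, inner ℝ (grad ψ x) (τ x) = 0) ∧
  (∀ v ∈ BUperp 𝒯 k δ B, -∫ x in Ω, inner ℝ (grad v x) (σ' x) = -F v)

end Scheme

end

end Kacanov

/-! Write `q = p'`, `ζ = [a, b]` and `w = weight q a b`. Since `κ' (t) = w t * t`, two facts about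
`w` carry the proof. As `w` is antitone, `κ` lies below the quadratic with weight `w s` that touches
it at `s` (`kappa_le_add`); hence the energy is majorized by a weighted quadratic functional
touching it at the old iterate, and the Kačanov step minimizes this functional over the admissible
set. As `w t * t - μ * t` is monotone for `μ = (q - 1) * b ^ (q - 2)`, `κ` is strongly convex with
modulus `μ` (`kappa_add_le`).

Let `x`, `y`, `z` be the old iterate, the new iterate and the minimizer. The majorant at `y` is
compared with its value at `x + r • (z - x)`. The quadratic error of this competitor, of order `r ^
2 * w`, is absorbed by `r` times the strong convexity term as soon as `r * w ≤ μ`. Because `w ≤ a ^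
(q - 2)`, the choice `r = (q - 1) * (a / b) ^ (2 - q)` suffices, so `c = q - 1`. All of this holds
pointwise (`kappa_decrease`), up to terms linear in `x - y` and `x - z` whose integrals vanish by
the saddle point equations. Iterating the decrease gives the geometric rate. -/

namespace Kacanov

/-- The weight `(max {a, min {t, b}}) ^ (q - 2)` of the relaxed scheme. -/
noncomputable def weight (q a b t : ℝ) : ℝ := (max a (min t b)) ^ (q - 2)

/-! ### Scalar convexity and growth of the integrand -/

section Scalar

variable {q a b : ℝ}

theorem weight_of_le {t : ℝ} (ht : t ≤ a) : weight q a b t = a ^ (q - 2) := by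
  rw [weight, max_eq_left ((min_le_left _ _).trans ht)]

theorem weight_of_mem {t : ℝ} (ht : t ∈ Icc a b) : weight q a b t = t ^ (q - 2) := by
  rw [weight, min_eq_left ht.2, max_eq_right ht.1]

theorem weight_of_ge {t : ℝ} (hab : a ≤ b) (ht : b ≤ t) : weight q a b t = b ^ (q - 2) := by
  rw [weight, min_eq_right ht, max_eq_right hab]

theorem weight_pos (ha : 0 < a) (t : ℝ) : 0 < weight q a b t :=
  Real.rpow_pos_of_pos (lt_max_of_lt_left ha) _

theorem weight_le (ha : 0 < a) (hq : q ≤ 2) (t : ℝ) : weight q a b t ≤ a ^ (q - 2) :=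
  Real.rpow_le_rpow_of_nonpos ha (le_max_left _ _) (by linarith)

theorem le_weight (ha : 0 < a) (hab : a ≤ b) (hq : q ≤ 2) (t : ℝ) :
    b ^ (q - 2) ≤ weight q a b t :=
  Real.rpow_le_rpow_of_nonpos (lt_max_of_lt_left ha) (max_le hab (min_le_right _ _))
    (by linarith)

theorem weight_antitone (ha : 0 < a) (hq : q ≤ 2) : Antitone (weight q a b) := fun _ _ h =>
  Real.rpow_le_rpow_of_nonpos (lt_max_of_lt_left ha) (max_le_max_left _ (min_le_min_right _ h))
    (by linarith)

theorem measurable_kappa : Measurable (kappa q a b) := by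
  unfold kappa
  refine Measurable.ite measurableSet_Iic (by fun_prop) ?_
  exact Measurable.ite measurableSet_Iic (by fun_prop) (by fun_prop)

theorem kappa_of_le {t : ℝ} (ht : t ≤ a) :
    kappa q a b t = 1 / 2 * a ^ (q - 2) * t ^ 2 + (1 / q - 1 / 2) * a ^ q := if_pos ht

/-- The additive constants in `kappa` are those that make the pieces agree at `a` and `b`. -/
theorem half_rpow_mul_sq {t : ℝ} (ht : 0 < t) :
    1 / 2 * t ^ (q - 2) * t ^ 2 + (1 / q - 1 / 2) * t ^ q = 1 / q * t ^ q := by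
  have : t ^ q = t ^ (q - 2) * t ^ 2 := by
    rw [← Real.rpow_natCast, ← Real.rpow_add ht]; norm_num
  rw [this]; ring

theorem kappa_of_mem {t : ℝ} (ha : 0 < a) (ht : t ∈ Icc a b) :
    kappa q a b t = 1 / q * t ^ q := by
  rcases ht.1.eq_or_lt with rfl | h
  · rw [kappa_of_le le_rfl, half_rpow_mul_sq ha]
  · rw [kappa, if_neg h.not_ge, if_pos ht.2]

theorem kappa_of_ge {t : ℝ} (ha : 0 < a) (hab : a ≤ b) (ht : b ≤ t) :
    kappa q a b t = 1 / 2 * b ^ (q - 2) * t ^ 2 + (1 / q - 1 / 2) * b ^ q := by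
  rcases ht.eq_or_lt with rfl | h
  · rw [kappa_of_mem ha ⟨hab, le_rfl⟩, half_rpow_mul_sq (ha.trans_le hab)]
  · rw [kappa, if_neg (hab.trans_lt h).not_ge, if_neg h.not_ge]

theorem rpow_sub_two_mul {t : ℝ} (ht : 0 < t) : t ^ (q - 2) * t = t ^ (q - 1) := by
  conv_lhs => rw [← Real.rpow_one t, ← Real.rpow_mul ht.le, one_mul, ← Real.rpow_add ht]
  ring_nf

theorem hasDerivAt_quadratic (m n t : ℝ) :
    HasDerivAt (fun t : ℝ => 1 / 2 * m * t ^ 2 + n) (m * t) t := by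
  have := (((hasDerivAt_id t).pow 2).const_mul (1 / 2 * m)).add_const n
  refine this.congr_deriv ?_
  simp; ring

theorem hasDerivAt_rpow_div (hq : 1 < q) {t : ℝ} (ht : 0 < t) :
    HasDerivAt (fun t : ℝ => 1 / q * t ^ q) (t ^ (q - 2) * t) t := by
  refine ((Real.hasDerivAt_rpow_const (Or.inl ht.ne')).const_mul (1 / q)).congr_deriv ?_
  rw [rpow_sub_two_mul ht]
  field_simp

/-- Each piece has this derivative on its closed interval. At `a` and `b` the one-sided derivatives
coincide, so the pieces glue. -/
theorem hasDerivAt_kappa (hq : 1 < q) (ha : 0 < a) (hab : a ≤ b) (t : ℝ) :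
    HasDerivAt (kappa q a b) (weight q a b t * t) t := by
  have h₁ : ∀ t ≤ a, HasDerivWithinAt (kappa q a b) (weight q a b t * t) (Iic a) t :=
    fun t ht => by
      rw [weight_of_le ht]
      exact (hasDerivAt_quadratic _ _ t).hasDerivWithinAt.congr (fun s hs => kappa_of_le hs)
        (kappa_of_le ht)
  have h₂ : ∀ t ∈ Icc a b, HasDerivWithinAt (kappa q a b) (weight q a b t * t) (Icc a b) t :=
    fun t ht => by
      rw [weight_of_mem ht]
      exact (hasDerivAt_rpow_div hq (ha.trans_le ht.1)).hasDerivWithinAt.congr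
        (fun s hs => kappa_of_mem ha hs) (kappa_of_mem ha ht)
  have h₃ : ∀ t, b ≤ t → HasDerivWithinAt (kappa q a b) (weight q a b t * t) (Ici b) t :=
    fun t ht => by
      rw [weight_of_ge hab ht]
      exact (hasDerivAt_quadratic _ _ t).hasDerivWithinAt.congr
        (fun s hs => kappa_of_ge ha hab hs) (kappa_of_ge ha hab ht)
  have h₄ : ∀ t, a ≤ t → HasDerivWithinAt (kappa q a b) (weight q a b t * t) (Ici a) t :=
    fun t ht => by
      rcases lt_trichotomy t b with h | rfl | h
      · exact (h₂ t ⟨ht, h.le⟩).mono_of_mem_nhdsWithin (inter_mem_nhdsWithin _ (Iic_mem_nhds h))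
      · rw [← Icc_union_Ici_eq_Ici hab]
        exact (h₂ t ⟨ht, le_rfl⟩).union (h₃ t le_rfl)
      · exact ((h₃ t h.le).hasDerivAt (Ici_mem_nhds h)).hasDerivWithinAt
  rcases lt_trichotomy t a with h | rfl | h
  · exact (h₁ t h.le).hasDerivAt (Iic_mem_nhds h)
  · rw [← hasDerivWithinAt_univ, ← Iic_union_Ici]
    exact (h₁ t le_rfl).union (h₄ t le_rfl)
  · exact (h₄ t h.le).hasDerivAt (Ici_mem_nhds h)

/-- On the outer pieces `weight q a b t * t` has slope `a ^ (q - 2)` or `b ^ (q - 2)`; in between it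
is `t ^ (q - 1)`, with slope `(q - 1) * t ^ (q - 2)`. All are at least `(q - 1) * b ^ (q - 2)`. -/
theorem monotone_weight_mul_sub (hq : 1 < q) (hq' : q ≤ 2) (ha : 0 < a) (hab : a ≤ b) :
    Monotone (fun t => weight q a b t * t - (q - 1) * b ^ (q - 2) * t) := by
  have hb : 0 < b := ha.trans_le hab
  have hbq : 0 < b ^ (q - 2) := Real.rpow_pos_of_pos hb _
  have habq : b ^ (q - 2) ≤ a ^ (q - 2) := Real.rpow_le_rpow_of_nonpos ha hab (by linarith)
  have hμ : (q - 1) * b ^ (q - 2) ≤ b ^ (q - 2) := by nlinarith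
  have h₁ : MonotoneOn (fun t => weight q a b t * t - (q - 1) * b ^ (q - 2) * t) (Iic a) := by
    intro s hs t ht hst
    dsimp only
    rw [weight_of_le hs, weight_of_le ht]
    nlinarith
  have h₂ : MonotoneOn (fun t => weight q a b t * t - (q - 1) * b ^ (q - 2) * t) (Icc a b) := by
    intro s hs t ht hst
    dsimp only
    have hs₀ := ha.trans_le hs.1
    have ht₀ := ha.trans_le ht.1
    rw [weight_of_mem hs, weight_of_mem ht, rpow_sub_two_mul hs₀]
    -- Bernoulli's inequality for the exponent `q - 1 ≤ 1`, that is, the tangent line of the concave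
    -- power at `t`.
    have hB : (s / t) ^ (q - 1) ≤ 1 + (q - 1) * (s / t - 1) := by
      have := rpow_one_add_le_one_add_mul_self (s := s / t - 1) (p := q - 1)
        (by have := div_pos hs₀ ht₀; linarith) (by linarith) (by linarith)
      rwa [add_sub_cancel] at this
    rw [Real.div_rpow hs₀.le ht₀.le, div_le_iff₀ (Real.rpow_pos_of_pos ht₀ _),
      ← rpow_sub_two_mul ht₀] at hB
    have h : (1 + (q - 1) * (s / t - 1)) * (t ^ (q - 2) * t)
        = t ^ (q - 2) * t - (q - 1) * t ^ (q - 2) * (t - s) := by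
      field_simp; ring
    have htb : b ^ (q - 2) ≤ t ^ (q - 2) := Real.rpow_le_rpow_of_nonpos ht₀ ht.2 (by linarith)
    have : (q - 1) * b ^ (q - 2) * (t - s) ≤ (q - 1) * t ^ (q - 2) * (t - s) := by
      gcongr
    linarith
  have h₃ : MonotoneOn (fun t => weight q a b t * t - (q - 1) * b ^ (q - 2) * t) (Ici b) := by
    intro s hs t ht hst
    dsimp only
    rw [weight_of_ge hab hs, weight_of_ge hab ht]
    nlinarith
  have h₄ := h₂.union_right h₃ (isGreatest_Icc hab) isLeast_Ici
  rw [Icc_union_Ici_eq_Ici hab] at h₄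
  exact h₁.Iic_union_Ici h₄

/-- `κ*_ζ` is strongly convex with modulus `(q - 1) b ^ (q - 2)`. -/
theorem kappa_add_le (hq : 1 < q) (hq' : q ≤ 2) (ha : 0 < a) (hab : a ≤ b) (s t : ℝ) :
    kappa q a b s + weight q a b s * s * (t - s) + (q - 1) * b ^ (q - 2) / 2 * (t - s) ^ 2 ≤
      kappa q a b t := by
  have hd : ∀ t, HasDerivAt (fun t => kappa q a b t - (1 / 2 * ((q - 1) * b ^ (q - 2)) * t ^ 2 + 0))
      (weight q a b t * t - (q - 1) * b ^ (q - 2) * t) t :=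
    fun t => (hasDerivAt_kappa hq ha hab t).sub (hasDerivAt_quadratic _ 0 t)
  have hc : ConvexOn ℝ univ
      (fun t => kappa q a b t - (1 / 2 * ((q - 1) * b ^ (q - 2)) * t ^ 2 + 0)) := by
    refine Monotone.convexOn_univ_of_deriv (fun t => (hd t).differentiableAt) ?_
    rw [show deriv _ = _ from funext fun t => (hd t).deriv]
    exact monotone_weight_mul_sub hq hq' ha hab
  rcases lt_trichotomy s t with h | rfl | h
  · have := hc.le_slope_of_hasDerivAt (mem_univ s) (mem_univ t) h (hd s)
    rw [slope_def_field, le_div_iff₀ (by linarith)] at this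
    nlinarith
  · simp
  · have := hc.slope_le_of_hasDerivAt (mem_univ t) (mem_univ s) h (hd s)
    rw [slope_def_field, div_le_iff₀ (by linarith)] at this
    nlinarith

/-- `t ↦ κ*_ζ(√t)` is concave. -/
theorem kappa_le_add (hq : 1 < q) (hq' : q ≤ 2) (ha : 0 < a) (hab : a ≤ b) {s t : ℝ}
    (hs : 0 ≤ s) (ht : 0 ≤ t) :
    kappa q a b t ≤ kappa q a b s + weight q a b s / 2 * (t ^ 2 - s ^ 2) := by
  -- The derivative `(weight t - weight s) * t` is nonnegative on `[0, s]` and nonpositive beyond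
  -- `s`, so on `[0, ∞)` the difference is largest at `s`.
  have hd : ∀ t, HasDerivAt (fun t => kappa q a b t - (1 / 2 * weight q a b s * t ^ 2 + 0))
      (weight q a b t * t - weight q a b s * t) t :=
    fun t => (hasDerivAt_kappa hq ha hab t).sub (hasDerivAt_quadratic _ 0 t)
  have hcont : Continuous (fun t => kappa q a b t - (1 / 2 * weight q a b s * t ^ 2 + 0)) :=
    continuous_iff_continuousAt.2 fun t => (hd t).continuousAt
  rcases le_total t s with h | h
  · have hm := monotoneOn_of_hasDerivWithinAt_nonneg (convex_Icc 0 s) hcont.continuousOn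
      (fun x _ => (hd x).hasDerivWithinAt) (fun x hx => by
        rw [interior_Icc] at hx
        have := weight_antitone (b := b) ha hq' hx.2.le
        nlinarith [hx.1]) ⟨ht, h⟩ ⟨hs, le_rfl⟩ h
    dsimp only at hm
    linarith
  · have hm := antitoneOn_of_hasDerivWithinAt_nonpos (convex_Ici s) hcont.continuousOn
      (fun x _ => (hd x).hasDerivWithinAt) (fun x hx => by
        rw [interior_Ici] at hx
        have := weight_antitone (b := b) ha hq' (le_of_lt hx)
        have hx' : s < x := hx
        nlinarith) (mem_Ici.2 le_rfl) (mem_Ici.2 h) h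
    dsimp only at hm
    linarith

theorem kappa_zero_nonneg (hq : 1 < q) (hq' : q ≤ 2) (ha : 0 < a) : 0 ≤ kappa q a b 0 := by
  rw [kappa_of_le ha.le]
  have : 1 / 2 ≤ 1 / q := one_div_le_one_div_of_le (by linarith) hq'
  have := Real.rpow_nonneg ha.le q
  have : 0 ≤ (1 / q - 1 / 2) * a ^ q := mul_nonneg (by linarith) this
  simpa using this

theorem mul_sq_le_kappa (hq : 1 < q) (hq' : q ≤ 2) (ha : 0 < a) (hab : a ≤ b) (t : ℝ) :
    (q - 1) * b ^ (q - 2) / 2 * t ^ 2 ≤ kappa q a b t := by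
  have := kappa_add_le hq hq' ha hab 0 t
  have := kappa_zero_nonneg (b := b) hq hq' ha
  simp only [mul_zero, zero_mul, sub_zero] at *
  linarith

theorem kappa_nonneg (hq : 1 < q) (hq' : q ≤ 2) (ha : 0 < a) (hab : a ≤ b) (t : ℝ) :
    0 ≤ kappa q a b t := by
  refine le_trans ?_ (mul_sq_le_kappa hq hq' ha hab t)
  have := Real.rpow_nonneg (ha.le.trans hab) (q - 2)
  have : 0 ≤ q - 1 := by linarith
  positivity

end Scalar

/-! ### Pointwise inequalities for vectors -/

section Pointwise

variable {q a b : ℝ} {E : Type*} [NormedAddCommGroup E] [InnerProductSpace ℝ E]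

/-- Compared with the scalar inequality for the norms, the left side drops by `(w - μ) * (‖x‖ * ‖y‖
- ⟪x, y⟫)`, which is nonnegative by Cauchy–Schwarz and `μ ≤ w`. -/
theorem kappa_norm_add_le (hq : 1 < q) (hq' : q ≤ 2) (ha : 0 < a) (hab : a ≤ b) (x y : E) :
    kappa q a b ‖x‖ + weight q a b ‖x‖ * inner ℝ x (y - x) +
      (q - 1) * b ^ (q - 2) / 2 * ‖y - x‖ ^ 2 ≤ kappa q a b ‖y‖ := by
  have h := kappa_add_le hq hq' ha hab ‖x‖ ‖y‖
  have hμ : (q - 1) * b ^ (q - 2) ≤ weight q a b ‖x‖ := by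
    have := le_weight ha hab hq' ‖x‖
    have := Real.rpow_nonneg (ha.le.trans hab) (q - 2)
    nlinarith
  have hi : 0 ≤ (weight q a b ‖x‖ - (q - 1) * b ^ (q - 2)) * (‖x‖ * ‖y‖ - inner ℝ x y) :=
    mul_nonneg (by linarith) (by linarith [real_inner_le_norm x y])
  rw [inner_sub_right, real_inner_self_eq_norm_sq, norm_sub_sq_real, real_inner_comm x y]
  linarith

/-- The pointwise form of the energy decrease: `x` is the old iterate, `y` the new one, and `z`
the minimizer. -/
theorem kappa_decrease (hq : 1 < q) (hq' : q ≤ 2) (ha : 0 < a) (hab : a ≤ b) {r : ℝ}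
    (hr : r = (q - 1) * (a / b) ^ (2 - q)) (x y z : E) :
    r * (kappa q a b ‖x‖ - kappa q a b ‖z‖) + weight q a b ‖x‖ * inner ℝ y (x - y)
      - r * (weight q a b ‖x‖ * inner ℝ y (x - z)) ≤ kappa q a b ‖x‖ - kappa q a b ‖y‖ := by
  have hb : 0 < b := ha.trans_le hab
  have hr₀ : 0 ≤ r := hr ▸ mul_nonneg (by linarith) (Real.rpow_nonneg (by positivity) _)
  have hw := weight_pos (q := q) (b := b) ha ‖x‖
  -- This bound dictates `r`: it solves `r * a ^ (q - 2) = (q - 1) * b ^ (q - 2)`.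
  have hrw : r * weight q a b ‖x‖ ≤ (q - 1) * b ^ (q - 2) := by
    refine (mul_le_mul_of_nonneg_left (weight_le ha hq' _) hr₀).trans_eq ?_
    rw [hr, Real.div_rpow ha.le hb.le, ← neg_sub q 2, Real.rpow_neg ha.le, Real.rpow_neg hb.le]
    have := Real.rpow_pos_of_pos ha (q - 2)
    have := Real.rpow_pos_of_pos hb (q - 2)
    field_simp
  have h₁ := kappa_le_add hq hq' ha hab (norm_nonneg x) (norm_nonneg y)
  have h₂ := mul_le_mul_of_nonneg_left (kappa_norm_add_le hq hq' ha hab x z) hr₀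
  have h₃ : r * (r * weight q a b ‖x‖) * ‖z - x‖ ^ 2 ≤ r * ((q - 1) * b ^ (q - 2)) * ‖z - x‖ ^ 2 := by
    gcongr
  -- Expanded around `y`, this square bounds the quadratic form at `y` by its value at the
  -- competitor `x + r • (z - x)`, up to the linear terms kept in the statement.
  have h₄ : 0 ≤ weight q a b ‖x‖ * ‖x + r • (z - x) - y‖ ^ 2 := by positivity
  generalize weight q a b ‖x‖ = w at *
  rw [sub_eq_add_neg, add_assoc, norm_add_sq_real, ← sub_eq_add_neg, norm_sub_sq_real, norm_smul,
    mul_pow, Real.norm_eq_abs, sq_abs] at h₄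
  simp only [inner_sub_right, inner_smul_left, inner_smul_right, inner_sub_left,
    real_inner_self_eq_norm_sq, RCLike.conj_to_real] at *
  have e₁ := real_inner_comm x y
  have e₂ := real_inner_comm x z
  have e₃ := real_inner_comm y z
  simp only [e₁, e₂, e₃] at *
  nlinarith

end Pointwise

/-! ### Measurability and almost everywhere representatives -/

section Measurability

variable {d : ℕ} {q a b : ℝ} {Ω : Set (EuclideanSpace ℝ (Fin d))}

theorem aestronglyMeasurable_kappa (τ : LVec Ω q) :
    AEStronglyMeasurable (fun x => kappa q a b ‖τ x‖) (volume.restrict Ω) :=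
  (measurable_kappa.comp_aemeasurable
    (Lp.aestronglyMeasurable τ).norm.aemeasurable).aestronglyMeasurable

theorem coeFn_sub_ae_inner (σ σ' τ υ : LVec Ω q) :
    (fun x => weight q a b ‖σ x‖ * inner ℝ (σ' x) ((τ - υ) x))
      =ᵐ[volume.restrict Ω]
      fun x => weight q a b ‖σ x‖ * inner ℝ (σ' x) (τ x - υ x) := by
  filter_upwards [Lp.coeFn_sub τ υ] with x hx
  rw [hx, Pi.sub_apply]

end Measurability

/-! ### Finite energies and the duality pairing -/

section Energy

variable {d : ℕ} {p : ℝ} [Fact (2 < p)] {Ω : Set (EuclideanSpace ℝ (Fin d))} {a b : ℝ}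

theorem one_lt_conjExponent (p : ℝ) [hp : Fact (2 < p)] : 1 < p.conjExponent := by
  have := hp.out
  rw [Real.conjExponent, lt_div_iff₀ (by linarith)]
  linarith

theorem conjExponent_lt_two (p : ℝ) [hp : Fact (2 < p)] : p.conjExponent < 2 := by
  have := hp.out
  rw [Real.conjExponent, div_lt_iff₀ (by linarith)]
  linarith

/-- The real-valued energy, meaningful where the integrand is integrable. -/
noncomputable def realEnergy (a b : ℝ) (τ : LVec Ω p.conjExponent) : ℝ :=
  ∫ x in Ω, kappa p.conjExponent a b ‖τ x‖

theorem energy_eq_coe (ha : 0 < a) (hab : a ≤ b) {τ : LVec Ω p.conjExponent}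
    (h : IntegrableOn (fun x => kappa p.conjExponent a b ‖τ x‖) Ω) :
    energy a b τ = (realEnergy a b τ : EReal) := by
  have h₀ : ∀ x, 0 ≤ kappa p.conjExponent a b ‖τ x‖ := fun x =>
    kappa_nonneg (one_lt_conjExponent p) (conjExponent_lt_two p).le ha hab _
  rw [energy, ← ofReal_integral_eq_lintegral_ofReal h (.of_forall h₀), realEnergy,
    EReal.coe_ennreal_ofReal, max_eq_left (integral_nonneg h₀)]

theorem integrableOn_kappa_of_energy_lt_top (ha : 0 < a) (hab : a ≤ b)
    {τ : LVec Ω p.conjExponent} (h : energy a b τ < ⊤) :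
    IntegrableOn (fun x => kappa p.conjExponent a b ‖τ x‖) Ω := by
  refine ⟨aestronglyMeasurable_kappa τ, ?_⟩
  rw [hasFiniteIntegral_iff_ofReal (.of_forall fun x =>
    kappa_nonneg (one_lt_conjExponent p) (conjExponent_lt_two p).le ha hab _)]
  rw [energy] at h
  exact EReal.coe_ennreal_lt_coe_ennreal_iff.1 h

theorem integrable_inner_grad (ψ : W0 Ω p) (τ : LVec Ω p.conjExponent) :
    IntegrableOn (fun x => inner ℝ (grad ψ x) (τ x)) Ω := by
  have hp : 2 < p := Fact.out
  have hpq : p.HolderConjugate p.conjExponent := Real.HolderConjugate.conjExponent (by linarith)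
  have : ENNReal.HolderConjugate (ENNReal.ofReal p) (ENNReal.ofReal p.conjExponent) :=
    hpq.ennrealOfReal
  refine ((Lp.memLp (grad ψ)).norm.integrable_mul (Lp.memLp τ).norm).mono
    ((Lp.aestronglyMeasurable _).inner (Lp.aestronglyMeasurable _)) (.of_forall fun x => ?_)
  simpa using norm_inner_le_norm (𝕜 := ℝ) (grad ψ x) (τ x)

end Energy

/-! ### One step of the iteration -/

section Step

variable {d : ℕ} {p : ℝ} [Fact (2 < p)] {Ω : Set (EuclideanSpace ℝ (Fin d))} {a b : ℝ}
  {𝒯 : Triangulation Ω} {k δ : ℕ} {B : W0 Ω p.conjExponent →L[ℝ] WNeg Ω p} {F : WNeg Ω p}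
  {σ σ' : LVec Ω p.conjExponent} {ψ : W0 Ω p}

theorem IsKacanovStep.mem_admissible (h : IsKacanovStep 𝒯 k δ B F a b σ σ' ψ) :
    σ' ∈ Admissible 𝒯 k δ B F := fun v hv => neg_injective (h.2.2 v hv)

theorem IsKacanovStep.integrableOn (h : IsKacanovStep 𝒯 k δ B F a b σ σ' ψ)
    (τ : LVec Ω p.conjExponent) :
    IntegrableOn (fun x => weight p.conjExponent a b ‖σ x‖ * inner ℝ (σ' x) (τ x)) Ω :=
  (h.2.1 τ).1

theorem IsKacanovStep.integrableOn_sub (h : IsKacanovStep 𝒯 k δ B F a b σ σ' ψ)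
    (τ υ : LVec Ω p.conjExponent) :
    IntegrableOn (fun x => weight p.conjExponent a b ‖σ x‖ * inner ℝ (σ' x) (τ x - υ x)) Ω :=
  (h.integrableOn (τ - υ)).congr (coeFn_sub_ae_inner σ σ' τ υ)

/-- The first equation turns the integral into the pairing of `grad ψ` with `τ - υ`, which is `F ψ -
F ψ` because `ψ` is itself an allowed test function in `Admissible`. -/
theorem IsKacanovStep.integral_sub_eq_zero (h : IsKacanovStep 𝒯 k δ B F a b σ σ' ψ)
    {τ υ : LVec Ω p.conjExponent} (hτ : τ ∈ Admissible 𝒯 k δ B F)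
    (hυ : υ ∈ Admissible 𝒯 k δ B F) :
    ∫ x in Ω, weight p.conjExponent a b ‖σ x‖ * inner ℝ (σ' x) (τ x - υ x) = 0 := by
  have h₁ : ∫ x in Ω, weight p.conjExponent a b ‖σ x‖ * inner ℝ (σ' x) ((τ - υ) x) =
      ∫ x in Ω, inner ℝ (grad ψ x) ((τ - υ) x) := sub_eq_zero.1 (h.2.1 (τ - υ)).2
  have h₂ : (fun x => inner ℝ (grad ψ x) ((τ - υ) x)) =ᵐ[volume.restrict Ω]
      fun x => inner ℝ (grad ψ x) (τ x) - inner ℝ (grad ψ x) (υ x) := by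
    filter_upwards [Lp.coeFn_sub τ υ] with x hx
    rw [hx, Pi.sub_apply, inner_sub_right]
  have h₃ := integral_congr_ae h₂
  have h₄ := integral_sub (integrable_inner_grad ψ τ) (integrable_inner_grad ψ υ)
  have h₅ := hτ ψ h.1
  have h₆ := hυ ψ h.1
  have h₇ := integral_congr_ae (coeFn_sub_ae_inner (a := a) (b := b) σ σ' τ υ)
  exact h₇.symm.trans (h₁.trans (h₃.trans (h₄.trans (sub_eq_zero.2 (h₅.trans h₆.symm)))))

/-- Testing the first equation with `σ'` itself makes the weighted square integrable. The weight is
bounded below, so `σ'` lies in `L^2`, and `kappa` grows at most quadratically. -/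
theorem IsKacanovStep.energy_lt_top (hΩ : Bornology.IsBounded Ω) (ha : 0 < a) (hab : a ≤ b)
    (h : IsKacanovStep 𝒯 k δ B F a b σ σ' ψ) : energy a b σ' < ⊤ := by
  have hq := one_lt_conjExponent p
  have hq' := (conjExponent_lt_two p).le
  have hb : 0 < b ^ (p.conjExponent - 2) := Real.rpow_pos_of_pos (ha.trans_le hab) _
  have : IsFiniteMeasure (volume.restrict Ω) := ⟨by simpa using hΩ.measure_lt_top⟩
  have hsq : Integrable (fun x => ‖σ' x‖ ^ 2) (volume.restrict Ω) := by
    refine ((h.integrableOn σ').const_mul (b ^ (p.conjExponent - 2))⁻¹).mono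
      ((Lp.aestronglyMeasurable σ').norm.pow 2) (.of_forall fun x => ?_)
    have hw := le_weight ha hab hq' ‖σ x‖
    rw [real_inner_self_eq_norm_sq, Real.norm_of_nonneg (by positivity), ← mul_assoc, norm_mul,
      Real.norm_of_nonneg (sq_nonneg ‖σ' x‖)]
    refine le_mul_of_one_le_left (sq_nonneg _) (le_trans ?_ (le_abs_self _))
    rwa [inv_mul_eq_div, one_le_div hb]
  have hint : IntegrableOn (fun x => kappa p.conjExponent a b ‖σ' x‖) Ω := by
    refine ((integrable_const (kappa p.conjExponent a b 0)).add
      (hsq.const_mul (weight p.conjExponent a b 0 / 2))).mono (aestronglyMeasurable_kappa σ')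
      (.of_forall fun x => ?_)
    rw [Real.norm_of_nonneg (kappa_nonneg hq hq' ha hab _)]
    refine le_trans ?_ (le_abs_self _)
    simpa using kappa_le_add hq hq' ha hab le_rfl (norm_nonneg (σ' x))
  rw [energy_eq_coe ha hab hint]
  exact EReal.coe_lt_top _

theorem IsKacanovStep.energy_decrease (ha : 0 < a) (hab : a ≤ b)
    (h : IsKacanovStep 𝒯 k δ B F a b σ σ' ψ) {υ : LVec Ω p.conjExponent}
    (hσ : σ ∈ Admissible 𝒯 k δ B F) (hυ : υ ∈ Admissible 𝒯 k δ B F)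
    (hσ_int : IntegrableOn (fun x => kappa p.conjExponent a b ‖σ x‖) Ω)
    (hσ'_int : IntegrableOn (fun x => kappa p.conjExponent a b ‖σ' x‖) Ω)
    (hυ_int : IntegrableOn (fun x => kappa p.conjExponent a b ‖υ x‖) Ω) {ρ : ℝ}
    (hρ : ρ = (p.conjExponent - 1) * (a / b) ^ (2 - p.conjExponent)) :
    ρ * (realEnergy a b σ - realEnergy a b υ) ≤ realEnergy a b σ - realEnergy a b σ' := by
  have i₁ := (hσ_int.sub hυ_int).const_mul ρ
  have i₂ := h.integrableOn_sub σ σ'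
  have i₃ := (h.integrableOn_sub σ υ).const_mul ρ
  have := integral_mono ((i₁.add i₂).sub i₃) (hσ_int.sub hσ'_int) fun x =>
    kappa_decrease (one_lt_conjExponent p) (conjExponent_lt_two p).le ha hab hρ (σ x) (σ' x) (υ x)
  rw [integral_sub' (i₁.add i₂) i₃, integral_add' i₁ i₂, integral_sub' hσ_int hσ'_int,
    integral_const_mul, integral_const_mul, h.integral_sub_eq_zero hσ h.mem_admissible,
    h.integral_sub_eq_zero hσ hυ] at this
  simp only [Pi.sub_apply] at this
  rw [integral_sub hσ_int hυ_int] at this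
  simpa [realEnergy] using this

end Step

end Kacanov

/-! ### Geometric convergence of the energies -/

theorem proposition4p1 (p : ℝ) [Fact (2 < p)] :
    ∃ c : ℝ, 0 < c ∧ c < 1 ∧
      ∀ (d : ℕ) (Ω : Set (EuclideanSpace ℝ (Fin d))), Kacanov.IsBoundedLipschitzDomain Ω →
      ∀ (𝒯 : Kacanov.Triangulation Ω) (k δ : ℕ), 1 ≤ k → 1 ≤ δ →
      ∀ (B : Kacanov.W0 Ω p.conjExponent →L[ℝ] Kacanov.WNeg Ω p) (F : Kacanov.WNeg Ω p)
        (ζm ζp : ℝ), 0 < ζm → ζm ≤ ζp →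
      ∀ (σζ : Kacanov.LVec Ω p.conjExponent),
        Kacanov.IsRegularizedMinimizer 𝒯 k δ B F ζm ζp σζ →
      ∀ (σ : ℕ → Kacanov.LVec Ω p.conjExponent) (ψ : ℕ → Kacanov.W0 Ω p),
        (∀ n, Kacanov.IsKacanovStep 𝒯 k δ B F ζm ζp (σ n) (σ (n + 1)) (ψ (n + 1))) →
      ∀ ρ : ℝ, ρ = c * (ζm / ζp) ^ (2 - p.conjExponent) →
      Kacanov.energy ζm ζp σζ < ⊤ ∧
      (∀ n, 1 ≤ n → Kacanov.energy ζm ζp (σ n) < ⊤) ∧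
      (∀ n, 1 ≤ n →
        (ρ : EReal) * (Kacanov.energy ζm ζp (σ n) - Kacanov.energy ζm ζp σζ) ≤
          Kacanov.energy ζm ζp (σ n) - Kacanov.energy ζm ζp (σ (n + 1))) ∧
      (∀ n, Kacanov.energy ζm ζp (σ (n + 1)) - Kacanov.energy ζm ζp σζ ≤
        (((1 - ρ) ^ n : ℝ) : EReal) *
          (Kacanov.energy ζm ζp (σ 1) - Kacanov.energy ζm ζp σζ)) ∧
      (σ 0 ∈ Kacanov.Admissible 𝒯 k δ B F →
        (∀ n, (ρ : EReal) * (Kacanov.energy ζm ζp (σ n) - Kacanov.energy ζm ζp σζ) ≤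
          Kacanov.energy ζm ζp (σ n) - Kacanov.energy ζm ζp (σ (n + 1))) ∧
        (∀ n, Kacanov.energy ζm ζp (σ (n + 1)) - Kacanov.energy ζm ζp σζ ≤
          (((1 - ρ) ^ n : ℝ) : EReal) *
            (Kacanov.energy ζm ζp (σ 0) - Kacanov.energy ζm ζp σζ))) := by
  have hq := Kacanov.one_lt_conjExponent p
  have hq' := Kacanov.conjExponent_lt_two p
  refine ⟨p.conjExponent - 1, by linarith, by linarith, ?_⟩
  intro d Ω hΩ 𝒯 k δ _ _ B F a b ha hab τ hτ σ ψ hstep ρ hρ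
  have hb : 0 < b := ha.trans_le hab
  have hr : 0 < (a / b) ^ (2 - p.conjExponent) := Real.rpow_pos_of_pos (by positivity) _
  have hr' : (a / b) ^ (2 - p.conjExponent) ≤ 1 :=
    Real.rpow_le_one (by positivity) ((div_le_one hb).2 hab) (by linarith)
  have hρ₀ : 0 < ρ := hρ ▸ mul_pos (by linarith) hr
  have hρ₁ : ρ < 1 := by rw [hρ]; nlinarith
  have hfin : ∀ n, Kacanov.energy a b (σ (n + 1)) < ⊤ := fun n =>
    (hstep n).energy_lt_top hΩ.isBounded ha hab
  -- The shift by one matters: every later iterate is admissible with finite energy, whereas `σ 0`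
  -- may be neither admissible nor of finite energy.
  have hadm : ∀ n, σ (n + 1) ∈ Kacanov.Admissible 𝒯 k δ B F := fun n => (hstep n).mem_admissible
  have hτfin : Kacanov.energy a b τ < ⊤ := (hτ.2 _ (hadm 0)).trans_lt (hfin 0)
  have hτint := Kacanov.integrableOn_kappa_of_energy_lt_top ha hab hτfin
  have hint := fun n => Kacanov.integrableOn_kappa_of_energy_lt_top ha hab (hfin n)
  have hτE := Kacanov.energy_eq_coe ha hab hτint
  have hE := fun n => Kacanov.energy_eq_coe ha hab (hint n)
  have hmin : ∀ n, Kacanov.realEnergy a b τ ≤ Kacanov.realEnergy a b (σ (n + 1)) := fun n => by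
    have := hτ.2 _ (hadm n)
    rwa [hτE, hE, EReal.coe_le_coe_iff] at this
  have hdec : ∀ n, ρ * (Kacanov.realEnergy a b (σ (n + 1)) - Kacanov.realEnergy a b τ) ≤
      Kacanov.realEnergy a b (σ (n + 1)) - Kacanov.realEnergy a b (σ (n + 1 + 1)) := fun n =>
    (hstep (n + 1)).energy_decrease ha hab (hadm n) hτ.1 (hint n) (hint (n + 1)) hτint hρ
  have hgeom : ∀ n, Kacanov.realEnergy a b (σ (n + 1)) - Kacanov.realEnergy a b τ ≤
      (1 - ρ) ^ n * (Kacanov.realEnergy a b (σ 1) - Kacanov.realEnergy a b τ) := fun n => by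
    induction n with
    | zero => simp
    | succ n ih =>
      have := mul_le_mul_of_nonneg_left ih (sub_nonneg.2 hρ₁.le)
      rw [pow_succ']
      linarith [hdec n]
  have hdecE : ∀ n, (ρ : EReal) * (Kacanov.energy a b (σ (n + 1)) - Kacanov.energy a b τ) ≤
      Kacanov.energy a b (σ (n + 1)) - Kacanov.energy a b (σ (n + 1 + 1)) := fun n => by
    rw [hτE, hE, hE]
    exact_mod_cast hdec n
  refine ⟨hτfin, ?_, ?_, ?_, ?_⟩
  · rintro (_ | n) hn
    · omega
    · exact hfin n
  · rintro (_ | n) hn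
    · omega
    · exact hdecE n
  · intro n
    rw [hτE, hE, hE 0]
    exact_mod_cast hgeom n
  · intro h0
    by_cases h0fin : Kacanov.energy a b (σ 0) < ⊤
    · have h0int := Kacanov.integrableOn_kappa_of_energy_lt_top ha hab h0fin
      have h0E := Kacanov.energy_eq_coe ha hab h0int
      have h0min : Kacanov.realEnergy a b τ ≤ Kacanov.realEnergy a b (σ 0) := by
        have := hτ.2 _ h0
        rwa [hτE, h0E, EReal.coe_le_coe_iff] at this
      have h0dec := (hstep 0).energy_decrease ha hab h0 hτ.1 h0int (hint 0) hτint hρ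
      refine ⟨?_, fun n => ?_⟩
      · rintro (_ | n)
        · rw [hτE, hE, h0E]
          exact_mod_cast h0dec
        · exact hdecE n
      · rw [hτE, hE, h0E]
        -- The first step does not increase the energy, so the gap of `σ 0` can replace that of `σ
        -- 1`.
        have h1 : Kacanov.realEnergy a b (σ 1) - Kacanov.realEnergy a b τ ≤
            Kacanov.realEnergy a b (σ 0) - Kacanov.realEnergy a b τ := by
          linarith [mul_nonneg hρ₀.le (sub_nonneg.2 h0min), h0dec]
        have := (hgeom n).trans
          (mul_le_mul_of_nonneg_left h1 (pow_nonneg (sub_nonneg.2 hρ₁.le) n))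
        exact_mod_cast this
    · have h0top : Kacanov.energy a b (σ 0) = ⊤ := not_lt_top_iff.1 h0fin
      refine ⟨?_, fun n => ?_⟩
      · rintro (_ | n)
        · rw [hE, h0top, EReal.top_sub_coe]
          exact le_top
        · exact hdecE n
      -- Strict positivity of `1 - ρ` is needed here: only then is the right side `⊤`.
      · rw [hτE, h0top, EReal.top_sub_coe,
          EReal.coe_mul_top_of_pos (pow_pos (sub_pos.2 hρ₁) n)]
        exact le_top
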